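/- **Notation.** For integers $k_1,\dots,k_r$ let ${\rm Li}_{k_1,\dots,k_r}(z)=\sum_{0<m_1<\cdots<m_r} \dfrac{z^{m_r}}{m_1^{k_1}\cdots m_r^{k_r}}$ for $|z|<1$, continued analytically to $\mathbb{C}\setminus[1,\infty)$. For integers $k\ge 1$, $n\ge 0$ and $\Re(s)>0$ put $$\eta(k,-n;s)=\frac{1}{\Gamma(s)}\int_0^\infty t^{s-1}\,\frac{{\rm Li}_{k,-n}(1-e^t)}{1-e^t}\,dt .$$ For integers $p_1,\dots,p_d\ge 1$ with $p_d\ge 2$ and real $\alpha_1,\dots,\alpha_d>0$ let $$\zeta^{\star}(p_1,\dots,p_d;\alpha_1,\dots,\alpha_d)=\sum_{0\le m_1\le\cdots\le m_d}\frac{1}{(m_1+\alpha_1)^{p_1}\cdots(m_d+\alpha_d)^{p_d}}$$ be the multiple Hurwitz zeta star value, with value $1$ when $d=0$, and let $\{\alpha\}^d=(\alpha,\dots,\alpha)$ ($d$ entries). (For $\alpha=1$ these are the multiple zeta star values.) For $0\le l<n$ and $0\le j\le n-l-1$ put $$A_{l,j}^{(n)}=\binom{n}{l}\sum_{b=0}^{n-l-j-1}\sum_{d=0}^{b+1}(-1)^{d+j}\binom{n-l+1}{d}\binom{n-l-b-1}{j}(b-d+1)^{n-l}.$$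 **Theorem.** Let $m\ge 0$, $k\ge 1$, $n\ge 0$ be integers with $k>n$. Then the integral defining $\eta(k,-n;m+1)$ converges absolutely and $$\begin{aligned}\eta(k,-n;m+1)=&-\sum_{l=0}^{n-1}\sum_{j=0}^{n-l-1}\ \sum_{\substack{a_{l+1}+\cdots+a_k=m\\ \forall a_i\ge 0}} A_{l,j}^{(n)}\,(a_k+1)\,\frac{1}{(n-l-j+1)^{a_{l+1}+1}}\\ &\qquad\times\zeta^{\star}\big(a_{l+2}+1,\dots,a_{k-1}+1,a_k+2;\{n-l-j+1\}^{k-l-1}\big)\\ &-\sum_{\substack{a_{n+1}+\cdots+a_k=m\\ \forall a_i\ge 0}}(a_k+1)\,\zeta^{\star}\big(a_{n+2}+1,\dots,a_{k-1}+1,a_k+2;\{1\}^{k-n-1}\big).\end{aligned}$$ Here the first sum is $0$ if $n=0$; if $n=k-1$, the index of $\zeta^\star$ in the last sum is empty, so that the last sum equals $m+1$. -/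

import Mathlib

open MeasureTheory

noncomputable section

/-- The strictly increasing tuples of `r + 1` positive integers, over which the series of the
multiple polylogarithm of depth `r + 1` is summed. -/
abbrev MPLIndex (r : ℕ) : Type :=
  {m : Fin (r + 1) → ℕ // StrictMono m ∧ ∀ i, 0 < m i}

/-- The power series of the multiple polylogarithm with integer indices `k_1, ..., k_r`,
`∑_{0 < m_1 < ... < m_r} z ^ {m_r} / (m_1 ^ {k_1} ... m_r ^ {k_r})`.
It converges absolutely for `|z| < 1`. -/
def mplSeries {r : ℕ} (k : Fin (r + 1) → ℤ) (z : ℂ) : ℂ :=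
  ∑' m : MPLIndex r, z ^ (m.1 (Fin.last r)) / ∏ i, ((m.1 i : ℂ) ^ (k i))

/-- The complex plane with the cut `[1, ∞)` removed. -/
def cutPlane : Set ℂ := {z | 1 - z ∈ Complex.slitPlane}

/-- `f` is an analytic continuation of the power series of the multiple polylogarithm from the
open unit disc to the cut plane. -/
structure IsMPLContinuation {r : ℕ} (k : Fin (r + 1) → ℤ) (f : ℂ → ℂ) : Prop where
  differentiableOn : DifferentiableOn ℂ f cutPlane
  eq_series : ∀ z : ℂ, ‖z‖ < 1 → f z = mplSeries k z

open Classical in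
/-- The multiple polylogarithm `Li_{k_1, ..., k_r}(z)` on the plane cut along `[1, ∞)`, that is, the
(unique) analytic continuation of its power series. -/
def multiPolylog {r : ℕ} (k : Fin (r + 1) → ℤ) (z : ℂ) : ℂ :=
  if h : ∃ f : ℂ → ℂ, IsMPLContinuation k f then h.choose z else 0

theorem isOpen_cutPlane : IsOpen cutPlane :=
  Complex.isOpen_slitPlane.preimage (continuous_const.sub continuous_id)

theorem isPreconnected_cutPlane : IsPreconnected cutPlane := by
  have h : cutPlane = (fun w : ℂ => 1 - w) '' Complex.slitPlane := by
    ext z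
    constructor
    · intro hz
      exact ⟨1 - z, hz, by ring⟩
    · rintro ⟨w, hw, rfl⟩
      simpa [cutPlane] using hw
  rw [h]
  have hs : IsPreconnected Complex.slitPlane :=
    (Complex.starConvex_one_slitPlane.isPathConnected
      Complex.one_mem_slitPlane).isConnected.isPreconnected
  exact hs.image _ (by fun_prop)

/-- The continuation is unique, so that `multiPolylog` does not depend on a choice. -/
theorem multiPolylog_eq {r : ℕ} {k : Fin (r + 1) → ℤ} {f : ℂ → ℂ} (hf : IsMPLContinuation k f)
    {z : ℂ} (hz : z ∈ cutPlane) : multiPolylog k z = f z := by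
  have h : ∃ f : ℂ → ℂ, IsMPLContinuation k f := ⟨f, hf⟩
  have hg : IsMPLContinuation k h.choose := h.choose_spec
  have hE : Set.EqOn h.choose f cutPlane := by
    refine (hg.differentiableOn.analyticOnNhd isOpen_cutPlane).eqOn_of_preconnected_of_eventuallyEq
      (hf.differentiableOn.analyticOnNhd isOpen_cutPlane) isPreconnected_cutPlane
      (z₀ := 0) (by simp [cutPlane]) ?_
    filter_upwards [Metric.ball_mem_nhds (0 : ℂ) one_pos] with w hw
    have hw' : ‖w‖ < 1 := by simpa using hw
    rw [hg.eq_series w hw', hf.eq_series w hw']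
  unfold multiPolylog
  rw [dif_pos h]
  exact hE hz

/-- The integrand `t ^ (s - 1) * Li_{k_1, ..., k_r}(1 - e ^ t) / (1 - e ^ t)`. -/
def etaIntegrand {r : ℕ} (k : Fin (r + 1) → ℤ) (s : ℂ) (t : ℝ) : ℂ :=
  (t : ℂ) ^ (s - 1) * (multiPolylog k (1 - Complex.exp t) / (1 - Complex.exp t))

/-- The function `η(k_1, ..., k_r; s)`, for `Re s > 0`. -/
def etaFn {r : ℕ} (k : Fin (r + 1) → ℤ) (s : ℂ) : ℂ :=
  1 / Complex.Gamma s * ∫ t in Set.Ioi (0 : ℝ), etaIntegrand k s t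

/-- The general term of the multiple Hurwitz zeta star value, indexed by
`0 ≤ m_1 ≤ ... ≤ m_d`. -/
def hurwitzStarTerm {d : ℕ} (p : Fin d → ℕ) (α : Fin d → ℝ)
    (m : {m : Fin d → ℕ // Monotone m}) : ℝ :=
  1 / ∏ i, ((m.1 i : ℝ) + α i) ^ (p i)

/-- The multiple Hurwitz zeta star value `ζ⋆(p_1, ..., p_d; α_1, ..., α_d)`,
which is `1` for `d = 0`. -/
def hurwitzZetaStar {d : ℕ} (p : Fin d → ℕ) (α : Fin d → ℝ) : ℝ :=
  ∑' m : {m : Fin d → ℕ // Monotone m}, hurwitzStarTerm p α m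

/-- The value for the empty index is `1`. -/
theorem hurwitzZetaStar_zero (p : Fin 0 → ℕ) (α : Fin 0 → ℝ) : hurwitzZetaStar p α = 1 := by
  have : Unique {m : Fin 0 → ℕ // Monotone m} :=
    { default := ⟨fun i => i.elim0, fun i => i.elim0⟩
      uniq := fun a => Subtype.ext (funext fun i => i.elim0) }
  simp [hurwitzZetaStar, hurwitzStarTerm]

/-- The family `1 / (x_1 + 1) ^ c ... 1 / (x_d + 1) ^ c` is summable for `c > 1`. -/
theorem summable_prod_rpow (c : ℝ) (hc : 1 < c) (d : ℕ) :
    Summable (fun m : Fin d → ℕ => ∏ i, 1 / ((m i : ℝ) + 1) ^ c) := by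
  induction d with
  | zero => exact Summable.of_finite
  | succ d ih =>
    have h1 : Summable (fun n : ℕ => 1 / ((n : ℝ) + 1) ^ c) := by
      have := (summable_nat_add_iff 1).2 (Real.summable_one_div_nat_rpow.2 hc)
      simpa using this
    have h2 := h1.mul_of_nonneg ih (fun n => by positivity)
      (fun m => Finset.prod_nonneg fun i _ => by positivity)
    rw [← (Fin.consEquiv (fun _ : Fin (d + 1) => ℕ)).summable_iff]
    refine h2.congr fun x => ?_
    simp [Fin.prod_univ_succ, Fin.consEquiv, mul_comm]

/-- The series of the multiple Hurwitz zeta star value converges whenever all `p_i` are positive,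
the last one is at least `2`, and all `α_i` are positive. -/
theorem summable_hurwitzStarTerm {d : ℕ} (p : Fin (d + 1) → ℕ) (α : Fin (d + 1) → ℝ)
    (hp : ∀ i, 1 ≤ p i) (hp2 : 2 ≤ p (Fin.last d)) (hα : ∀ i, 0 < α i) :
    Summable (hurwitzStarTerm p α) := by
  set c : ℝ := 1 + 1 / ((d : ℝ) + 1) with hc
  have hc1 : 1 < c := by
    have : (0 : ℝ) < 1 / ((d : ℝ) + 1) := by positivity
    linarith
  have hS := ((summable_prod_rpow c hc1 (d + 1)).comp_injective
    (Subtype.val_injective (p := fun m : Fin (d + 1) → ℕ => Monotone m))).mul_left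
      (∏ i, (1 / min (α i) 1) ^ (p i))
  refine Summable.of_nonneg_of_le (fun m => ?_) (fun m => ?_) hS
  · unfold hurwitzStarTerm
    refine one_div_nonneg.2 (Finset.prod_nonneg fun i _ => ?_)
    have := (hα i).le
    positivity
  · obtain ⟨m, hm⟩ := m
    have hx : ∀ i, (1 : ℝ) ≤ (m i : ℝ) + 1 := fun i => by
      have : (0 : ℝ) ≤ (m i : ℝ) := Nat.cast_nonneg _
      linarith
    have hβ : ∀ i, 0 < min (α i) 1 := fun i => lt_min (hα i) one_pos
    have hA : ∀ i, min (α i) 1 * ((m i : ℝ) + 1) ≤ (m i : ℝ) + α i := fun i => by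
      have h0 : (0 : ℝ) ≤ (m i : ℝ) := Nat.cast_nonneg _
      nlinarith [min_le_left (α i) 1, min_le_right (α i) 1]
    have hB : ∏ i, ((m i : ℝ) + 1) ^ c ≤ ∏ i, ((m i : ℝ) + 1) ^ (p i) := by
      have e1 : ∏ i, ((m i : ℝ) + 1) ^ c =
          (∏ i, ((m i : ℝ) + 1)) * ∏ i, ((m i : ℝ) + 1) ^ (1 / ((d : ℝ) + 1)) := by
        rw [← Finset.prod_mul_distrib]
        refine Finset.prod_congr rfl fun i _ => ?_
        rw [hc, Real.rpow_add (by linarith [hx i]), Real.rpow_one]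
      have e2 : ∏ i, ((m i : ℝ) + 1) ^ (1 / ((d : ℝ) + 1)) ≤ (m (Fin.last d) : ℝ) + 1 := by
        calc ∏ i, ((m i : ℝ) + 1) ^ (1 / ((d : ℝ) + 1))
            ≤ ∏ _i : Fin (d + 1), ((m (Fin.last d) : ℝ) + 1) ^ (1 / ((d : ℝ) + 1)) := by
              refine Finset.prod_le_prod (fun i _ => by positivity) fun i _ => ?_
              refine Real.rpow_le_rpow (by positivity) ?_ (by positivity)
              have : (m i : ℝ) ≤ m (Fin.last d) := by exact_mod_cast hm (Fin.le_last i)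
              linarith
          _ = (m (Fin.last d) : ℝ) + 1 := by
              rw [Finset.prod_const, Finset.card_univ, Fintype.card_fin, ← Real.rpow_natCast,
                ← Real.rpow_mul (by positivity)]
              have : (1 / ((d : ℝ) + 1)) * ((d + 1 : ℕ) : ℝ) = 1 := by
                push_cast
                field_simp
              rw [this, Real.rpow_one]
      rw [e1]
      calc (∏ i, ((m i : ℝ) + 1)) * ∏ i, ((m i : ℝ) + 1) ^ (1 / ((d : ℝ) + 1))
          ≤ (∏ i, ((m i : ℝ) + 1)) * ((m (Fin.last d) : ℝ) + 1) := by gcongr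
        _ ≤ ∏ i, ((m i : ℝ) + 1) ^ (p i) := by
            rw [Fin.prod_univ_castSucc, Fin.prod_univ_castSucc, mul_assoc]
            refine mul_le_mul ?_ ?_ (by positivity) (by positivity)
            · refine Finset.prod_le_prod (fun i _ => by positivity) fun i _ => ?_
              exact le_self_pow₀ (hx _) (by have := hp i.castSucc; omega)
            · rw [← sq]
              exact pow_le_pow_right₀ (hx _) hp2
    have hC : (∏ i, (min (α i) 1) ^ (p i)) * ∏ i, ((m i : ℝ) + 1) ^ c ≤
        ∏ i, ((m i : ℝ) + α i) ^ (p i) := by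
      calc _ ≤ (∏ i, (min (α i) 1) ^ (p i)) * ∏ i, ((m i : ℝ) + 1) ^ (p i) :=
            mul_le_mul_of_nonneg_left hB
              (Finset.prod_nonneg fun i _ => pow_nonneg (hβ i).le _)
        _ = ∏ i, (min (α i) 1 * ((m i : ℝ) + 1)) ^ (p i) := by
            rw [← Finset.prod_mul_distrib]
            exact Finset.prod_congr rfl fun i _ => (mul_pow _ _ _).symm
        _ ≤ _ := Finset.prod_le_prod
            (fun i _ => pow_nonneg (mul_nonneg (hβ i).le (by positivity)) _)
            fun i _ => pow_le_pow_left₀ (mul_nonneg (hβ i).le (by positivity)) (hA i) _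
    have hpos : 0 < (∏ i, (min (α i) 1) ^ (p i)) * ∏ i, ((m i : ℝ) + 1) ^ c :=
      mul_pos (Finset.prod_pos fun i _ => pow_pos (hβ i) _)
        (Finset.prod_pos fun i _ => by positivity)
    calc hurwitzStarTerm p α ⟨m, hm⟩
        ≤ 1 / ((∏ i, (min (α i) 1) ^ (p i)) * ∏ i, ((m i : ℝ) + 1) ^ c) :=
          one_div_le_one_div_of_le hpos hC
      _ = _ := by
          simp only [Function.comp, one_div, Finset.prod_inv_distrib, mul_inv, inv_pow]

/-- The rational coefficients
`A_{l,j}^{(n)} = binom(n, l) ∑_{b=0}^{n-l-j-1} ∑_{d=0}^{b+1} (-1)^{d+j} binom(n-l+1, d)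
binom(n-l-b-1, j) (b-d+1)^{n-l}`, for `0 ≤ l < n` and `0 ≤ j < n - l`. -/
def coeffA (n l j : ℕ) : ℚ :=
  (n.choose l : ℚ) * ∑ b ∈ Finset.range (n - l - j), ∑ d ∈ Finset.range (b + 2),
    (-1 : ℚ) ^ (d + j) * ((n - l + 1).choose d : ℚ) * ((n - l - b - 1).choose j : ℚ) *
      ((b : ℚ) - (d : ℚ) + 1) ^ (n - l)

/-- The index `(a_{i+1} + 1, ..., a_{k-1} + 1, a_k + 2)` of length `k - i`, for a family `a` that is
numbered as `a_1, a_2, ...`; it is empty if `i = k`. -/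
def starIndex (a : ℕ → ℕ) (i k : ℕ) : Fin (k - i) → ℕ :=
  fun q => if i + 1 + (q : ℕ) = k then a k + 2 else a (i + 1 + (q : ℕ)) + 1

end

/-! Writing m_2 = m_1 + r and expanding m_2 ^ n by the binomial theorem gives Li_{k,-n} = ∑_{l ≤ n}
binom(n, l) Li_{k-l} Li_{-(n-l)} (`mplSeries_depth_two`); since k > n, every index k - l is
positive. The quotient Li_{-p}(z) / z is a polynomial in 1 / (1 - z) built from Eulerian numbers
(`hasSum_negPolylogQuot`), and 1 / (1 - z) = e^{-t} at z = 1 - e^t. Hence the integrand is a finite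
combination of terms t^m e^{-Nt} Li_q(1 - e^t) with N > 0 and q ≥ 1.

Let M_q(N, m) be the integral of -Li_q(1 - e^t) against t^m e^{-Nt} / m!. The derivative of
-Li_{q+1}(1 - e^t) is -Li_q(1 - e^t) / (1 - e^{-t}). Expanding the geometric series and exchanging
the integrals gives M_{q+1}(N, m) = ∑_{a+b=m} N^{-a-1} ∑_{i ≥ 0} M_q(N + i, b)
(`polylogMoment_succ`), with M_1(N, m) = (m + 1) / N^{m+2}. Sums of star values obey the same
recursion when the smallest summation variable is split off (`weightSum_succ`). All quantities are
nonnegative, so the comparison takes place in [0, ∞]; convergence of the star series then gives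
absolute convergence of the integral. -/

/-! ### Depth-one polylogarithms on the cut plane -/

section Polylogarithm

open Set Filter Topology Interval

/-- The function `Li_q(z) / z`, as an iterated integral over the segment `[0, z]`. -/
noncomputable def polylogQuot : ℕ → ℂ → ℂ
  | 0, z => (1 - z)⁻¹
  | q + 1, z => ∫ u in (0 : ℝ)..1, polylogQuot q (u * z)

/-- The function `Li_q(x) / x` of a real variable. -/
noncomputable def polylogQuotReal : ℕ → ℝ → ℝ
  | 0, x => (1 - x)⁻¹
  | q + 1, x => ∫ u in (0 : ℝ)..1, polylogQuotReal q (u * x)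

theorem polylogQuot_ofReal (q : ℕ) (x : ℝ) :
    polylogQuot q (x : ℂ) = (polylogQuotReal q x : ℂ) := by
  induction q generalizing x with
  | zero => simp [polylogQuot, polylogQuotReal]
  | succ q ih =>
    simp only [polylogQuot, polylogQuotReal]
    rw [← intervalIntegral.integral_ofReal]
    refine intervalIntegral.integral_congr fun u _ => ?_
    rw [← ih]
    push_cast
    rfl

/-- The slit plane is star-shaped about 1, hence the cut plane about 0, so the iterated integrals
over [0, z] never meet the cut. -/
theorem smul_mem_cutPlane {z : ℂ} (hz : z ∈ cutPlane) {u : ℝ} (hu : u ∈ Icc (0 : ℝ) 1) :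
    (u : ℂ) * z ∈ cutPlane := by
  have h := Complex.starConvex_one_slitPlane (y := 1 - z) hz (a := 1 - u) (b := u)
    (by linarith [hu.2]) hu.1 (by ring)
  have e : (1 - u) • (1 : ℂ) + u • (1 - z) = 1 - u * z := by
    simp only [Complex.real_smul]
    push_cast
    ring
  rw [e] at h
  exact h

theorem ofReal_mem_cutPlane {x : ℝ} (hx : x < 1) : (x : ℂ) ∈ cutPlane := by
  have : (1 - x : ℝ) ∈ {y : ℝ | 0 < y} := by
    simpa using hx
  have h : ((1 - x : ℝ) : ℂ) ∈ Complex.slitPlane := Complex.ofReal_mem_slitPlane.2 this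
  simpa [cutPlane] using h

/-- Averaging a holomorphic function over the segment from `0` gives a holomorphic function. -/
theorem differentiableOn_integral_segment {f : ℂ → ℂ} (hf : DifferentiableOn ℂ f cutPlane) :
    DifferentiableOn ℂ (fun z => ∫ u in (0 : ℝ)..1, f (u * z)) cutPlane := by
  intro z₀ hz₀
  obtain ⟨ε, hε, hball⟩ := Metric.nhds_basis_closedBall.mem_iff.1 (isOpen_cutPlane.mem_nhds hz₀)
  have hf' : ContinuousOn (deriv f) cutPlane :=
    ((hf.analyticOnNhd isOpen_cutPlane).deriv).continuousOn
  have hsub : MapsTo (fun p : ℝ × ℂ => (p.1 : ℂ) * p.2)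
      (Icc (0 : ℝ) 1 ×ˢ Metric.closedBall z₀ ε) cutPlane :=
    fun p hp => smul_mem_cutPlane (hball hp.2) hp.1
  have hG : ContinuousOn (fun p : ℝ × ℂ => (p.1 : ℂ) * deriv f (p.1 * p.2))
      (Icc (0 : ℝ) 1 ×ˢ Metric.closedBall z₀ ε) :=
    ContinuousOn.mul (by fun_prop) (hf'.comp (by fun_prop) hsub)
  -- `C` bounds the z-derivative of the integrand on a compact product; as a constant it dominates
  -- for differentiation under the integral.
  obtain ⟨C, hC⟩ := (isCompact_Icc.prod (isCompact_closedBall z₀ ε)).exists_bound_of_continuousOn hG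
  have hz₀' : z₀ ∈ Metric.closedBall z₀ ε := Metric.mem_closedBall_self hε.le
  have hcont : ∀ z ∈ cutPlane, ContinuousOn (fun u : ℝ => f (u * z)) (Icc 0 1) := fun z hz =>
    hf.continuousOn.comp (by fun_prop) fun u hu => smul_mem_cutPlane hz hu
  have hae : ∀ (g : ℝ → ℂ), ContinuousOn g (Icc 0 1) →
      AEStronglyMeasurable g (volume.restrict (Ι (0 : ℝ) 1)) := fun g hg => by
    rw [uIoc_of_le zero_le_one]
    exact (hg.mono Ioc_subset_Icc_self).aestronglyMeasurable measurableSet_Ioc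
  refine (intervalIntegral.hasDerivAt_integral_of_dominated_loc_of_deriv_le
    (F := fun z (u : ℝ) => f (u * z)) (F' := fun z (u : ℝ) => u * deriv f (u * z))
    (bound := fun _ => C) (Metric.closedBall_mem_nhds z₀ hε) ?_ ?_ ?_ ?_ ?_ ?_).2.differentiableAt
      |>.differentiableWithinAt
  · filter_upwards [isOpen_cutPlane.mem_nhds hz₀] with z hz
    exact hae _ (hcont z hz)
  · refine ContinuousOn.intervalIntegrable ?_
    rw [uIcc_of_le zero_le_one]
    exact hcont _ hz₀
  · refine hae _ ?_
    exact hG.comp (f := fun u : ℝ => (u, z₀)) (by fun_prop) fun u hu => ⟨hu, hz₀'⟩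
  · refine ae_of_all _ fun u hu z hz => ?_
    rw [uIoc_of_le zero_le_one] at hu
    exact hC (u, z) ⟨Ioc_subset_Icc_self hu, hz⟩
  · exact intervalIntegrable_const
  · refine ae_of_all _ fun u hu z hz => ?_
    rw [uIoc_of_le zero_le_one] at hu
    have hm := smul_mem_cutPlane (hball hz) (Ioc_subset_Icc_self hu)
    have h1 := (hf.differentiableAt (isOpen_cutPlane.mem_nhds hm)).hasDerivAt
    have h2 : HasDerivAt (fun z : ℂ => (u : ℂ) * z) u z := by
      simpa using (hasDerivAt_id z).const_mul (u : ℂ)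
    have h3 := h1.comp z h2
    rw [mul_comm] at h3
    exact h3

theorem differentiableOn_polylogQuot (q : ℕ) : DifferentiableOn ℂ (polylogQuot q) cutPlane := by
  induction q with
  | zero =>
    intro z hz
    have h : (1 : ℂ) - z ≠ 0 := Complex.slitPlane_ne_zero hz
    have : DifferentiableAt ℂ (fun z : ℂ => (1 - z)⁻¹) z :=
      DifferentiableAt.inv (by fun_prop) h
    exact this.differentiableWithinAt
  | succ q ih => exact differentiableOn_integral_segment ih

/-- Since ∫₀¹ u^i du = 1 / (i + 1), each averaging step divides the i-th coefficient by i + 1; the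
geometric series in ‖z‖ justifies termwise integration. -/
theorem hasSum_polylogQuot (q : ℕ) {z : ℂ} (hz : ‖z‖ < 1) :
    HasSum (fun i : ℕ => z ^ i / ((i : ℂ) + 1) ^ q) (polylogQuot q z) := by
  induction q generalizing z with
  | zero => simpa [polylogQuot] using hasSum_geometric_of_norm_lt_one hz
  | succ q ih =>
    have hb : ∀ i : ℕ, ∀ u ∈ Icc (0 : ℝ) 1,
        ‖((u : ℂ) * z) ^ i / ((i : ℂ) + 1) ^ q‖ ≤ ‖z‖ ^ i := by
      intro i u hu
      rw [norm_div, norm_pow, norm_pow, norm_mul]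
      have h1 : (1 : ℝ) ≤ ‖(i : ℂ) + 1‖ ^ q := by
        refine one_le_pow₀ ?_
        have : ((i : ℂ) + 1) = ((i + 1 : ℕ) : ℂ) := by push_cast; rfl
        rw [this, Complex.norm_natCast]
        simp
      have h2 : ‖(u : ℂ)‖ * ‖z‖ ≤ ‖z‖ := by
        rw [Complex.norm_real, Real.norm_of_nonneg hu.1]
        exact mul_le_of_le_one_left (norm_nonneg _) hu.2
      calc (‖(u : ℂ)‖ * ‖z‖) ^ i / ‖(i : ℂ) + 1‖ ^ q ≤ (‖(u : ℂ)‖ * ‖z‖) ^ i :=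
            div_le_self (by positivity) h1
        _ ≤ ‖z‖ ^ i := by gcongr
    have hs := intervalIntegral.hasSum_integral_of_dominated_convergence (μ := volume)
      (a := (0 : ℝ)) (b := 1) (F := fun (i : ℕ) (u : ℝ) => ((u : ℂ) * z) ^ i / ((i : ℂ) + 1) ^ q)
      (f := fun u : ℝ => polylogQuot q (u * z)) (fun i _ => ‖z‖ ^ i)
      (fun (i : ℕ) => (by fun_prop : Continuous fun u : ℝ =>
        ((u : ℂ) * z) ^ i / ((i : ℂ) + 1) ^ q).aestronglyMeasurable)
      (fun i => ae_of_all _ fun u hu => hb i u ?_)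
      (ae_of_all _ fun u _ => summable_geometric_of_lt_one (norm_nonneg _) hz)
      intervalIntegrable_const
      (ae_of_all _ fun u hu => ih ?_)
    · have key : ∀ i : ℕ, ∫ u in (0 : ℝ)..1, ((u : ℂ) * z) ^ i / ((i : ℂ) + 1) ^ q =
          z ^ i / ((i : ℂ) + 1) ^ (q + 1) := by
        intro i
        have : ∀ u : ℝ, ((u : ℂ) * z) ^ i / ((i : ℂ) + 1) ^ q =
            ((u ^ i : ℝ) : ℂ) * (z ^ i / ((i : ℂ) + 1) ^ q) := fun u => by
          push_cast
          ring
        simp_rw [this]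
        rw [intervalIntegral.integral_mul_const, intervalIntegral.integral_ofReal, integral_pow]
        push_cast
        have hi : (i : ℂ) + 1 ≠ 0 := Nat.cast_add_one_ne_zero i
        field_simp
        simp
        ring
      simp_rw [key] at hs
      exact hs
    · rw [uIoc_of_le zero_le_one] at hu
      exact Ioc_subset_Icc_self hu
    · rw [uIoc_of_le zero_le_one] at hu
      rw [norm_mul, Complex.norm_real, Real.norm_of_nonneg hu.1.le]
      exact lt_of_le_of_lt (mul_le_of_le_one_left (norm_nonneg _) hu.2) hz

theorem continuousOn_polylogQuotReal (q : ℕ) : ContinuousOn (polylogQuotReal q) (Iio 1) := by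
  have h : ContinuousOn (fun x : ℝ => (polylogQuot q (x : ℂ)).re) (Iio 1) :=
    Complex.continuous_re.comp_continuousOn
      ((differentiableOn_polylogQuot q).continuousOn.comp (by fun_prop)
        fun x hx => ofReal_mem_cutPlane hx)
  refine h.congr fun x _ => ?_
  simp only
  rw [polylogQuot_ofReal, Complex.ofReal_re]

theorem polylogQuotReal_nonneg (q : ℕ) {x : ℝ} (hx : x < 1) : 0 ≤ polylogQuotReal q x := by
  induction q generalizing x with
  | zero => exact inv_nonneg.2 (by linarith)
  | succ q ih =>
    refine intervalIntegral.integral_nonneg zero_le_one fun u hu => ih ?_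
    rcases le_total x 0 with h | h
    · nlinarith [hu.1]
    · nlinarith [hu.2]

end Polylogarithm

/-! ### Moments of polylogarithms and their recursion -/

section Moments

open Set Filter Topology Interval
open scoped ENNReal Nat

/-- The function `-Li_q(1 - e ^ t)`. -/
noncomputable def polylogNeg (q : ℕ) (t : ℝ) : ℝ :=
  (Real.exp t - 1) * polylogQuotReal q (1 - Real.exp t)

/-- The derivative of `-Li_{q+1}(1 - e ^ t)`. -/
noncomputable def polylogDensity (q : ℕ) (t : ℝ) : ℝ :=
  polylogQuotReal q (1 - Real.exp t) * Real.exp t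

theorem continuous_polylogQuotReal_comp (q : ℕ) :
    Continuous fun t => polylogQuotReal q (1 - Real.exp t) :=
  (continuousOn_polylogQuotReal q).comp_continuous (by fun_prop) fun t => by
    have := Real.exp_pos t
    simp only [mem_Iio]
    linarith

theorem continuous_polylogDensity (q : ℕ) : Continuous (polylogDensity q) :=
  (continuous_polylogQuotReal_comp q).mul Real.continuous_exp

theorem continuous_polylogNeg (q : ℕ) : Continuous (polylogNeg q) :=
  Continuous.mul (by fun_prop) (continuous_polylogQuotReal_comp q)

theorem polylogQuotReal_comp_nonneg (q : ℕ) (t : ℝ) :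
    0 ≤ polylogQuotReal q (1 - Real.exp t) :=
  polylogQuotReal_nonneg q (by have := Real.exp_pos t; linarith)

theorem polylogDensity_nonneg (q : ℕ) (t : ℝ) : 0 ≤ polylogDensity q t :=
  mul_nonneg (polylogQuotReal_comp_nonneg q t) (Real.exp_pos t).le

theorem polylogNeg_nonneg (q : ℕ) {t : ℝ} (ht : 0 ≤ t) : 0 ≤ polylogNeg q t :=
  mul_nonneg (by have := Real.one_le_exp ht; linarith) (polylogQuotReal_comp_nonneg q t)

/-- Substitute x = 1 - e^v in Li_{q+1}(1 - e^t) = ∫ Li_q(x) / x dx, taken from 0 to 1 - e^t. -/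
theorem polylogNeg_succ (q : ℕ) (t : ℝ) :
    polylogNeg (q + 1) t = ∫ v in (0 : ℝ)..t, polylogDensity q v := by
  have h1 := intervalIntegral.integral_comp_mul_deriv'' (a := 0) (b := t)
    (f := fun v => 1 - Real.exp v) (f' := fun v => -Real.exp v) (g := polylogQuotReal q)
    (by fun_prop) (fun x _ => ((Real.hasDerivAt_exp x).const_sub 1).hasDerivWithinAt)
    (by fun_prop) ((continuousOn_polylogQuotReal q).mono ?_)
  · have h2 := intervalIntegral.smul_integral_comp_mul_right (a := 0) (b := 1)
      (polylogQuotReal q) (1 - Real.exp t)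
    simp only [Real.exp_zero, sub_self, zero_mul, one_mul] at h1 h2
    rw [← h2] at h1
    have h3 : ∀ v, (polylogQuotReal q ∘ fun v => 1 - Real.exp v) v * -Real.exp v =
        -polylogDensity q v := fun v => by
      simp [polylogDensity]
    simp_rw [h3] at h1
    rw [intervalIntegral.integral_neg, smul_eq_mul] at h1
    rw [polylogNeg, polylogQuotReal]
    linarith
  · rintro _ ⟨v, _, rfl⟩
    have := Real.exp_pos v
    simp only [mem_Iio]
    linarith

theorem polylogNeg_one (t : ℝ) : polylogNeg 1 t = t := by
  rw [polylogNeg_succ]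
  have : ∀ v, polylogDensity 0 v = 1 := fun v => by
    have := (Real.exp_pos v).ne'
    simp [polylogDensity, polylogQuotReal, this]
  simp [this]

theorem ofReal_polylogNeg_succ (q : ℕ) {t : ℝ} (ht : 0 ≤ t) :
    ENNReal.ofReal (polylogNeg (q + 1) t) =
      ∫⁻ v in Ioc 0 t, ENNReal.ofReal (polylogDensity q v) := by
  rw [polylogNeg_succ, intervalIntegral.integral_of_le ht, ofReal_integral_eq_lintegral_ofReal]
  · exact ((continuous_polylogDensity q).integrableOn_Icc).mono_set Ioc_subset_Icc_self
  · exact ae_of_all _ fun v => polylogDensity_nonneg q v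

/-- The ratio of density to -Li_q(1 - e^u) is e^u / (e^u - 1) = 1 / (1 - e^{-u}), a geometric series
for u > 0. Its terms e^{-iu} will shift the parameter N of the kernel to N + i. -/
theorem ofReal_polylogDensity (q : ℕ) {u : ℝ} (hu : 0 < u) :
    ENNReal.ofReal (polylogDensity q u) =
      ∑' i : ℕ, ENNReal.ofReal (Real.exp (-(i * u)) * polylogNeg q u) := by
  have h0 : Real.exp (-u) < 1 := by simpa using hu
  have h1 := (hasSum_geometric_of_lt_one (Real.exp_pos (-u)).le h0).mul_right (polylogNeg q u)
  have h2 : ∀ i : ℕ, Real.exp (-u) ^ i = Real.exp (-(i * u)) := fun i => by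
    rw [← Real.exp_nat_mul]
    ring_nf
  simp_rw [h2] at h1
  have h3 : (1 - Real.exp (-u))⁻¹ * polylogNeg q u = polylogDensity q u := by
    have h4 : 1 < Real.exp u := Real.one_lt_exp_iff.2 hu
    have h5 : (1 - Real.exp (-u))⁻¹ = Real.exp u / (Real.exp u - 1) := by
      have h6 : Real.exp u - 1 ≠ 0 := by linarith
      rw [Real.exp_neg]
      have := (Real.exp_pos u).ne'
      rw [inv_eq_iff_eq_inv, inv_div]
      field_simp
    have h6 : Real.exp u - 1 ≠ 0 := by linarith
    rw [h5, polylogNeg, polylogDensity]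
    field_simp
  rw [h3] at h1
  rw [← h1.tsum_eq, ENNReal.ofReal_tsum_of_nonneg _ h1.summable]
  exact fun i => mul_nonneg (Real.exp_pos _).le (polylogNeg_nonneg q hu.le)

/-- The kernel `t ^ m e ^ {-N t} / m!`. -/
noncomputable def gammaKernel (m : ℕ) (N t : ℝ) : ℝ := t ^ m / m ! * Real.exp (-(N * t))

theorem continuous_gammaKernel (m : ℕ) (N : ℝ) : Continuous (gammaKernel m N) := by
  unfold gammaKernel
  fun_prop

theorem gammaKernel_nonneg (m : ℕ) (N : ℝ) {t : ℝ} (ht : 0 ≤ t) : 0 ≤ gammaKernel m N t := by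
  unfold gammaKernel
  positivity

theorem tendsto_gammaKernel (m : ℕ) {N : ℝ} (hN : 0 < N) :
    Tendsto (gammaKernel m N) atTop (𝓝 0) := by
  have h := ((Real.tendsto_pow_mul_exp_neg_atTop_nhds_zero m).comp
    (tendsto_id.const_mul_atTop hN)).const_mul (((m ! : ℝ) * N ^ m)⁻¹)
  rw [mul_zero] at h
  refine h.congr fun t => ?_
  simp only [Function.comp, id, gammaKernel, mul_pow]
  field_simp

theorem hasDerivAt_gammaKernel_zero (N t : ℝ) :
    HasDerivAt (gammaKernel 0 N) (-(N * gammaKernel 0 N t)) t := by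
  have h1 : HasDerivAt (fun t : ℝ => -(N * t)) (-N) t := by
    simpa using! ((hasDerivAt_id t).const_mul N).neg
  have h2 : gammaKernel 0 N = fun t => Real.exp (-(N * t)) := by
    ext
    simp [gammaKernel]
  rw [h2]
  exact h1.exp.congr_deriv (by ring)

theorem hasDerivAt_gammaKernel_succ (m : ℕ) (N t : ℝ) :
    HasDerivAt (gammaKernel (m + 1) N)
      (gammaKernel m N t - N * gammaKernel (m + 1) N t) t := by
  have h1 : HasDerivAt (fun t : ℝ => -(N * t)) (-N) t := by
    simpa using! ((hasDerivAt_id t).const_mul N).neg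
  have h2 := ((hasDerivAt_pow (m + 1) t).div_const ((m + 1)! : ℝ)).mul h1.exp
  refine h2.congr_deriv ?_
  simp only [gammaKernel, Nat.factorial_succ]
  push_cast
  simp
  field_simp
  ring

/-- This antiderivative comes from repeated integration by parts; it vanishes at infinity, so minus
its value at u is the tail integral of the kernel. -/
theorem hasDerivAt_sum_gammaKernel (m : ℕ) {N : ℝ} (hN : 0 < N) (t : ℝ) :
    HasDerivAt (fun t => -∑ a ∈ Finset.HasAntidiagonal.antidiagonal m,
      1 / N ^ (a.1 + 1) * gammaKernel a.2 N t)
      (gammaKernel m N t) t := by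
  induction m with
  | zero =>
    simp only [Finset.Nat.antidiagonal_zero, Finset.sum_singleton, zero_add, pow_one]
    refine ((hasDerivAt_gammaKernel_zero N t).const_mul (1 / N)).neg.congr_deriv ?_
    field_simp
  | succ m ih =>
    have e : (fun t => -∑ a ∈ Finset.HasAntidiagonal.antidiagonal (m + 1),
        1 / N ^ (a.1 + 1) * gammaKernel a.2 N t) =
        fun t => -(1 / N * gammaKernel (m + 1) N t) + 1 / N *
          -∑ a ∈ Finset.HasAntidiagonal.antidiagonal m, 1 / N ^ (a.1 + 1) * gammaKernel a.2 N t := by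
      funext t
      simp only [Finset.Nat.sum_antidiagonal_succ, zero_add, pow_one, mul_neg, Finset.mul_sum,
        neg_add]
      congr 2
      refine Finset.sum_congr rfl fun a _ => ?_
      rw [pow_succ N (a.1 + 1)]
      field_simp
    rw [e]
    refine ((((hasDerivAt_gammaKernel_succ m N t).const_mul (1 / N)).neg).add
      (ih.const_mul (1 / N))).congr_deriv ?_
    field_simp
    ring

theorem lintegral_gammaKernel (m : ℕ) {N u : ℝ} (hN : 0 < N) (hu : 0 ≤ u) :
    ∫⁻ t in Ioi u, ENNReal.ofReal (gammaKernel m N t) =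
      ∑ a ∈ Finset.HasAntidiagonal.antidiagonal m,
        ENNReal.ofReal (1 / N ^ (a.1 + 1)) * ENNReal.ofReal (gammaKernel a.2 N u) := by
  have hlim : Tendsto (fun t => -∑ a ∈ Finset.HasAntidiagonal.antidiagonal m,
      1 / N ^ (a.1 + 1) * gammaKernel a.2 N t) atTop (𝓝 0) := by
    have := (tendsto_finsetSum (Finset.HasAntidiagonal.antidiagonal m) fun a _ =>
      (tendsto_gammaKernel a.2 hN).const_mul (1 / N ^ (a.1 + 1))).neg
    simpa using this
  have hpos : ∀ t ∈ Ioi u, 0 ≤ gammaKernel m N t := fun t ht =>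
    gammaKernel_nonneg m N (hu.trans (le_of_lt ht))
  have hint := integrableOn_Ioi_deriv_of_nonneg' (a := u)
    (fun t _ => hasDerivAt_sum_gammaKernel m hN t) hpos hlim
  have hval := integral_Ioi_of_hasDerivAt_of_nonneg' (a := u)
    (fun t _ => hasDerivAt_sum_gammaKernel m hN t) hpos hlim
  rw [← ofReal_integral_eq_lintegral_ofReal hint
    ((ae_restrict_iff' measurableSet_Ioi).2 (ae_of_all _ hpos)), hval, zero_sub, neg_neg,
    ENNReal.ofReal_sum_of_nonneg]
  · refine Finset.sum_congr rfl fun a _ => ?_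
    rw [ENNReal.ofReal_mul (by positivity)]
  · intro a _
    have := gammaKernel_nonneg a.2 N hu
    positivity

/-- The moments of `-Li_q(1 - e ^ t)` against the kernel `t ^ m e ^ {-N t} / m!`. -/
noncomputable def polylogMoment (q : ℕ) (N : ℝ) (m : ℕ) : ℝ≥0∞ :=
  ∫⁻ t in Ioi (0 : ℝ), ENNReal.ofReal (gammaKernel m N t * polylogNeg q t)

theorem polylogMoment_one {N : ℝ} (hN : 0 < N) (m : ℕ) :
    polylogMoment 1 N m = ENNReal.ofReal ((m + 1) / N ^ (m + 2)) := by
  have h : ∀ t, gammaKernel m N t * polylogNeg 1 t = (m + 1) * gammaKernel (m + 1) N t := by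
    intro t
    simp only [polylogNeg_one, gammaKernel, Nat.factorial_succ]
    push_cast
    field_simp
    ring
  unfold polylogMoment
  simp_rw [h]
  have h1 : ∀ t, ENNReal.ofReal ((m + 1) * gammaKernel (m + 1) N t) =
      ENNReal.ofReal (m + 1) * ENNReal.ofReal (gammaKernel (m + 1) N t) := fun t =>
    ENNReal.ofReal_mul (by positivity)
  simp_rw [h1]
  rw [lintegral_const_mul _ (continuous_gammaKernel _ _).measurable.ennreal_ofReal,
    -- At u = 0 a kernel with a positive power of t vanishes, so only the pair (m + 1, 0)
    -- contributes.
    lintegral_gammaKernel _ hN le_rfl, Finset.sum_eq_single (m + 1, 0)]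
  · rw [← ENNReal.ofReal_mul (by positivity), ← ENNReal.ofReal_mul (by positivity)]
    congr 1
    simp [gammaKernel]
    ring
  · rintro ⟨a, b⟩ hab hne
    have : b ≠ 0 := by
      rintro rfl
      simp at hab hne
      exact hne hab
    simp [gammaKernel, this]
  · intro h
    simp at h

/-- Tonelli's theorem on the region 0 < u ≤ t. -/
theorem lintegral_mul_lintegral_Ioc {f g : ℝ → ℝ≥0∞} (hf : Measurable f) (hg : Measurable g) :
    ∫⁻ t in Ioi (0 : ℝ), f t * ∫⁻ u in Ioc 0 t, g u =
      ∫⁻ u in Ioi (0 : ℝ), g u * ∫⁻ t in Ioi u, f t := by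
  have hS : MeasurableSet {p : ℝ × ℝ | p.2 ≤ p.1} := measurableSet_le measurable_snd measurable_fst
  have h1 : ∀ t ∈ Ioi (0 : ℝ), f t * ∫⁻ u in Ioc 0 t, g u =
      ∫⁻ u in Ioi (0 : ℝ), {p : ℝ × ℝ | p.2 ≤ p.1}.indicator (fun p => f p.1 * g p.2) (t, u) := by
    intro t _
    rw [← lintegral_const_mul _ hg, ← lintegral_indicator measurableSet_Ioc,
      ← lintegral_indicator measurableSet_Ioi]
    refine lintegral_congr fun u => ?_
    by_cases h0 : 0 < u <;> by_cases ht : u ≤ t <;> simp [indicator, h0, ht]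
  have h2 : ∀ u ∈ Ioi (0 : ℝ), g u * ∫⁻ t in Ioi u, f t =
      ∫⁻ t in Ioi (0 : ℝ), {p : ℝ × ℝ | p.2 ≤ p.1}.indicator (fun p => f p.1 * g p.2) (t, u) := by
    intro u hu
    rw [← lintegral_const_mul _ hf, setLIntegral_congr Ioi_ae_eq_Ici,
      ← lintegral_indicator measurableSet_Ici, ← lintegral_indicator measurableSet_Ioi]
    refine lintegral_congr fun t => ?_
    have hu' : 0 < u := hu
    by_cases ht : u ≤ t
    · have : 0 < t := hu'.trans_le ht
      simp [indicator, ht, this, mul_comm]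
    · simp [indicator, ht]
  rw [setLIntegral_congr_fun measurableSet_Ioi h1, setLIntegral_congr_fun measurableSet_Ioi h2]
  refine lintegral_lintegral_swap (f := fun t u =>
    {p : ℝ × ℝ | p.2 ≤ p.1}.indicator (fun p => f p.1 * g p.2) (t, u)) ?_
  exact (((hf.comp measurable_fst).mul (hg.comp measurable_snd)).indicator hS).aemeasurable

/-- After the exchange of integrals the kernel is integrated over (u, ∞), which produces the powers
of 1 / N, and the geometric series of the density produces the sum over i. -/
theorem polylogMoment_succ (q : ℕ) {N : ℝ} (hN : 0 < N) (m : ℕ) :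
    polylogMoment (q + 1) N m = ∑ a ∈ Finset.HasAntidiagonal.antidiagonal m,
      ENNReal.ofReal (1 / N ^ (a.1 + 1)) * ∑' i : ℕ, polylogMoment q (N + i) a.2 := by
  have h1 : ∀ t ∈ Ioi (0 : ℝ), ENNReal.ofReal (gammaKernel m N t * polylogNeg (q + 1) t) =
      ENNReal.ofReal (gammaKernel m N t) *
        ∫⁻ v in Ioc 0 t, ENNReal.ofReal (polylogDensity q v) := fun t ht => by
    rw [ENNReal.ofReal_mul (gammaKernel_nonneg m N (le_of_lt ht)),
      ofReal_polylogNeg_succ q (le_of_lt ht)]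
  have h2 : ∀ u ∈ Ioi (0 : ℝ), ENNReal.ofReal (polylogDensity q u) *
      ∫⁻ t in Ioi u, ENNReal.ofReal (gammaKernel m N t) =
      ∑ a ∈ Finset.HasAntidiagonal.antidiagonal m, ENNReal.ofReal (1 / N ^ (a.1 + 1)) *
        ∑' i : ℕ, ENNReal.ofReal (gammaKernel a.2 (N + i) u * polylogNeg q u) := fun u hu => by
    rw [lintegral_gammaKernel m hN (le_of_lt hu), Finset.mul_sum]
    refine Finset.sum_congr rfl fun a _ => ?_
    rw [mul_left_comm, ofReal_polylogDensity q hu, mul_comm (∑' _, _), ← ENNReal.tsum_mul_left]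
    congr 2
    ext i
    rw [← ENNReal.ofReal_mul (gammaKernel_nonneg _ _ (le_of_lt hu))]
    congr 1
    simp only [gammaKernel]
    rw [add_mul, neg_add, Real.exp_add]
    ring
  have hm : ∀ (i : ℕ) (b : ℕ), Measurable fun u : ℝ =>
      ENNReal.ofReal (gammaKernel b (N + i) u * polylogNeg q u) := fun i b =>
    ((continuous_gammaKernel b _).mul (continuous_polylogNeg q)).measurable.ennreal_ofReal
  rw [polylogMoment, setLIntegral_congr_fun measurableSet_Ioi h1,
    lintegral_mul_lintegral_Ioc (continuous_gammaKernel m N).measurable.ennreal_ofReal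
      (continuous_polylogDensity q).measurable.ennreal_ofReal,
    setLIntegral_congr_fun measurableSet_Ioi h2, lintegral_finsetSum]
  · refine Finset.sum_congr rfl fun a _ => ?_
    rw [lintegral_const_mul _ (Measurable.tsum fun i => hm i a.2),
      lintegral_tsum fun i => (hm i a.2).aemeasurable]
    rfl
  · exact fun a _ => (Measurable.tsum fun i => hm i a.2).const_mul _

end Moments

/-! ### Star sums satisfy the recursion of the moments -/

section StarSums

open scoped ENNReal

/-- The sum defining the multiple Hurwitz zeta star value with constant shift `N`, with values in
`[0, ∞]`. -/
noncomputable def starSum {d : ℕ} (p : Fin d → ℕ) (N : ℝ) : ℝ≥0∞ :=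
  ∑' m : {m : Fin d → ℕ // Monotone m}, ENNReal.ofReal (hurwitzStarTerm p (fun _ => N) m)

/-- A monotone tuple is its first entry together with the differences to it. -/
def monotoneConsEquiv (d : ℕ) :
    ℕ × {m : Fin d → ℕ // Monotone m} ≃ {m : Fin (d + 1) → ℕ // Monotone m} where
  toFun x := ⟨Fin.cons x.1 fun j => x.1 + x.2.1 j, by
    intro i j hij
    induction i using Fin.cases with
    | zero =>
      induction j using Fin.cases with
      | zero => exact le_rfl
      | succ j => simp
    | succ i =>
      induction j using Fin.cases with
      | zero => simp at hij
      | succ j => simpa using x.2.2 (Fin.succ_le_succ_iff.1 hij)⟩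
  invFun m := (m.1 0, ⟨fun j => m.1 j.succ - m.1 0, fun i j hij =>
    Nat.sub_le_sub_right (m.2 (Fin.succ_le_succ_iff.2 hij)) _⟩)
  left_inv x := by
    ext <;> simp
  right_inv m := by
    ext j
    induction j using Fin.cases with
    | zero => simp
    | succ j =>
      have := m.2 (Fin.zero_le j.succ)
      simp only [Fin.cons_succ]
      omega

theorem hurwitzStarTerm_nonneg {d : ℕ} (p : Fin d → ℕ) {N : ℝ} (hN : 0 < N)
    (m : {m : Fin d → ℕ // Monotone m}) : 0 ≤ hurwitzStarTerm p (fun _ => N) m := by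
  unfold hurwitzStarTerm
  positivity

theorem starSum_zero (p : Fin 0 → ℕ) (N : ℝ) : starSum p N = 1 := by
  have : Unique {m : Fin 0 → ℕ // Monotone m} :=
    { default := ⟨fun i => i.elim0, fun i => i.elim0⟩
      uniq := fun a => Subtype.ext (funext fun i => i.elim0) }
  simp [starSum, hurwitzStarTerm]

/-- Fix the smallest variable i: the differences of the others to i again form an arbitrary monotone
tuple, now with shift N + i. -/
theorem starSum_succ {d : ℕ} (p : Fin (d + 1) → ℕ) {N : ℝ} (hN : 0 < N) :
    starSum p N =
      ∑' i : ℕ, ENNReal.ofReal (1 / (N + i) ^ p 0) * starSum (fun j => p j.succ) (N + i) := by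
  rw [starSum, ← (monotoneConsEquiv d).tsum_eq, ENNReal.tsum_prod']
  refine tsum_congr fun i => ?_
  rw [starSum, ← ENNReal.tsum_mul_left]
  refine tsum_congr fun m => ?_
  rw [← ENNReal.ofReal_mul (by positivity)]
  congr 1
  simp only [hurwitzStarTerm, monotoneConsEquiv, Equiv.coe_fn_mk, Fin.prod_univ_succ,
    Fin.cons_zero, Fin.cons_succ]
  rw [← one_div_mul_one_div, add_comm (i : ℝ)]
  congr 3
  funext j
  push_cast
  ring

/-- The exponents `a_i + 1`, with an additional `1` at the last place `k`. -/
def starExponent (a : ℕ → ℕ) (k i : ℕ) : ℕ := if i = k then a k + 2 else a i + 1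

/-- The sum of multiple zeta star values over the indices of weight `m`, with values in
`[0, ∞]`. -/
noncomputable def weightSum (d l : ℕ) (N : ℝ) (m : ℕ) : ℝ≥0∞ :=
  ∑ a ∈ Finset.piAntidiag (Finset.Icc l (l + d)) m,
    ENNReal.ofReal (a (l + d) + 1) * (ENNReal.ofReal (1 / N ^ starExponent a (l + d) l) *
      starSum (fun q : Fin d => starExponent a (l + d) (l + 1 + q)) N)

theorem weightSum_zero (l : ℕ) (N : ℝ) (m : ℕ) :
    weightSum 0 l N m = ENNReal.ofReal ((m + 1) / N ^ (m + 2)) := by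
  have h : Finset.piAntidiag (Finset.Icc l (l + 0)) m = {Pi.single l m} := by
    ext f
    simp only [add_zero, Finset.Icc_self, Finset.mem_piAntidiag, Finset.sum_singleton,
      Finset.mem_singleton]
    constructor
    · rintro ⟨h1, h2⟩
      funext i
      by_cases hi : i = l
      · subst hi
        simp [h1]
      · rw [Pi.single_eq_of_ne hi]
        by_contra h
        exact hi (h2 i h)
    · rintro rfl
      refine ⟨by simp, fun i hi => ?_⟩
      by_contra h
      exact hi (Pi.single_eq_of_ne h _)
  rw [weightSum, h, Finset.sum_singleton, starSum_zero, mul_one,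
    ← ENNReal.ofReal_mul (by positivity)]
  simp [starExponent, div_eq_mul_inv]

/-- Splitting off the entry at l gives the antidiagonal sum. Splitting off the smallest variable of
the star sum gives the sum over i, whose factor 1 / (N + i) ^ p is the leading factor of the shorter
weighted sum. -/
theorem weightSum_succ (d l : ℕ) {N : ℝ} (hN : 0 < N) (m : ℕ) :
    weightSum (d + 1) l N m = ∑ c ∈ Finset.HasAntidiagonal.antidiagonal m,
      ENNReal.ofReal (1 / N ^ (c.1 + 1)) * ∑' i : ℕ, weightSum d (l + 1) (N + i) c.2 := by
  have hs : l ∉ Finset.Icc (l + 1) (l + 1 + d) := by simp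
  have hI : Finset.Icc l (l + (d + 1)) = Finset.cons l (Finset.Icc (l + 1) (l + 1 + d)) hs := by
    ext i
    simp only [Finset.mem_Icc, Finset.mem_cons]
    omega
  rw [weightSum, hI, Finset.piAntidiag_cons, Finset.sum_disjiUnion]
  refine Finset.sum_congr rfl fun c _ => ?_
  rw [Finset.sum_map]
  simp only [weightSum]
  have hsw : ∀ (s : Finset (ℕ → ℕ)) (F : (ℕ → ℕ) → ℕ → ℝ≥0∞),
      ∑' i, ∑ a ∈ s, F a i = ∑ a ∈ s, ∑' i, F a i := fun _ _ =>
    Summable.tsum_finsetSum fun _ _ => ENNReal.summable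
  rw [hsw, Finset.mul_sum]
  refine Finset.sum_congr rfl fun f hf => ?_
  have hfl : f l = 0 := by
    by_contra h
    exact hs ((Finset.mem_piAntidiag.1 hf).2 l h)
  have hk : l + (d + 1) = l + 1 + d := by omega
  set a : ℕ → ℕ := addRightEmbedding (fun t => if t = l then c.1 else 0) f with ha
  have hal : a l = c.1 := by simp [ha, hfl]
  have hai : ∀ i, l < i → a i = f i := fun i hi => by simp [ha, hi.ne']
  have he : ∀ i, l < i → starExponent a (l + 1 + d) i = starExponent f (l + 1 + d) i := by
    intro i hi
    simp only [starExponent]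
    rw [hai i hi, hai (l + 1 + d) (by omega)]
  have hel : starExponent a (l + 1 + d) l = c.1 + 1 := by
    rw [starExponent, if_neg (by omega), hal]
  rw [hk, hai (l + 1 + d) (by omega), hel, starSum_succ _ hN, ENNReal.tsum_mul_left, mul_left_comm]
  congr 3
  funext i
  rw [he _ (by simp)]
  congr 2
  funext q
  rw [he _ (by omega)]
  congr 1
  simp
  omega

theorem polylogMoment_eq_weightSum (d l : ℕ) {N : ℝ} (hN : 0 < N) (m : ℕ) :
    polylogMoment (d + 1) N m = weightSum d l N m := by
  induction d generalizing l N m with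
  | zero => rw [polylogMoment_one hN, weightSum_zero]
  | succ d ih =>
    rw [polylogMoment_succ (d + 1) hN, weightSum_succ d l hN]
    refine Finset.sum_congr rfl fun c _ => ?_
    congr 1
    exact tsum_congr fun i => ih (l + 1) (by positivity) c.2

theorem starSum_eq_ofReal {l k : ℕ} {d : ℕ} (hk : k = l + d) (a : ℕ → ℕ) {N : ℝ} (hN : 0 < N) :
    starSum (fun q : Fin d => starExponent a (l + d) (l + 1 + q)) N =
      ENNReal.ofReal (hurwitzZetaStar (starIndex a l k) fun _ => N) := by
  have hd : k - l = d := by omega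
  subst hk
  -- The length k - l equals d only propositionally, so the claim is generalised over the length
  -- before substituting.
  have h1 : ∀ (d' : ℕ) (h : d' = d) (p : Fin d' → ℕ),
      (∀ q, p q = starExponent a (l + d) (l + 1 + q)) →
      starSum (fun q : Fin d => starExponent a (l + d) (l + 1 + q)) N =
        ENNReal.ofReal (hurwitzZetaStar p fun _ => N) := by
    rintro d' rfl p hp
    have hp' : (fun q : Fin d' => starExponent a (l + d') (l + 1 + q)) = p :=
      funext fun q => (hp q).symm
    rw [hp']
    cases d' with
    | zero => rw [starSum_zero, hurwitzZetaStar_zero, ENNReal.ofReal_one]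
    | succ d =>
      rw [starSum, hurwitzZetaStar, ENNReal.ofReal_tsum_of_nonneg
        (hurwitzStarTerm_nonneg p hN)]
      -- The only use of convergence: the last exponent is at least 2, which makes all moments
      -- finite.
      refine summable_hurwitzStarTerm p _ (fun i => ?_) ?_ fun _ => hN
      · rw [hp, starExponent]
        split_ifs <;> omega
      · rw [hp, starExponent, if_pos (by simp; omega)]
        omega
  refine h1 _ hd _ fun q => ?_
  simp only [starIndex, starExponent]

/-- The moments of `-Li_{d+1}(1 - e ^ t)` as sums of multiple Hurwitz zeta star values. -/
theorem polylogMoment_eq_ofReal {l k : ℕ} {d : ℕ} (hk : k = l + d) {N : ℝ} (hN : 0 < N) (m : ℕ) :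
    polylogMoment (d + 1) N m = ENNReal.ofReal
      (∑ a ∈ Finset.piAntidiag (Finset.Icc l k) m, ((a k : ℝ) + 1) *
        (1 / N ^ starExponent a k l) * hurwitzZetaStar (starIndex a l k) fun _ => N) := by
  rw [polylogMoment_eq_weightSum d l hN, weightSum, ENNReal.ofReal_sum_of_nonneg]
  · rw [hk]
    refine Finset.sum_congr rfl fun a _ => ?_
    rw [starSum_eq_ofReal rfl a hN, mul_assoc, ENNReal.ofReal_mul (by positivity),
      ENNReal.ofReal_mul (by positivity)]
  · intro a _
    have : 0 ≤ hurwitzZetaStar (starIndex a l k) fun _ => N :=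
      tsum_nonneg fun m => hurwitzStarTerm_nonneg _ hN m
    positivity

end StarSums

/-! ### Eulerian numbers and polylogarithms of nonpositive index -/

section Eulerian

open Finset

/-- The Eulerian numbers, as alternating sums. -/
def eulerianSum (p s : ℕ) : ℂ :=
  ∑ d ∈ range (s + 2), (-1 : ℂ) ^ d * ((p + 1).choose d : ℂ) * ((s : ℂ) - d + 1) ^ p

/-- This is a (p + 1)-st finite difference of a polynomial of degree p. -/
theorem sum_alternating_choose_mul_pow (p : ℕ) (x : ℂ) :
    ∑ d ∈ range (p + 2), (-1 : ℂ) ^ d * ((p + 1).choose d : ℂ) * (x - d) ^ p = 0 := by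
  have h := congrFun (fwdDiff_iter_pow_eq_zero_of_lt (R := ℂ) (Nat.lt_succ_self p)) (x - (p + 1))
  rw [fwdDiff_iter_eq_sum_shift] at h
  rw [← sum_range_reflect]
  rw [Pi.zero_apply] at h
  rw [← h]
  refine sum_congr rfl fun d hd => ?_
  have hd' : d ≤ p + 1 := by have := mem_range.1 hd; omega
  have e : p + 2 - 1 - d = p + 1 - d := by omega
  rw [e, Nat.choose_symm hd', Nat.cast_sub hd']
  simp only [Nat.succ_eq_add_one, zsmul_eq_mul, nsmul_eq_mul, mul_one]
  push_cast
  ring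

theorem eulerianSum_eq_zero {p s : ℕ} (hs : p ≤ s) : eulerianSum p s = 0 := by
  rw [eulerianSum, ← sum_alternating_choose_mul_pow p (s + 1)]
  symm
  refine sum_subset_zero_on_sdiff (range_mono (by omega)) ?_ fun d _ => by ring
  intro d hd
  have : p + 1 < d := by
    simp only [mem_sdiff, mem_range] at hd
    omega
  simp [Nat.choose_eq_zero_of_lt this]

/-- Cut the vanishing complete alternating sum after d = b + 1: the lower part is one Eulerian
number, and the upper part, reflected by d ↦ p + 1 - d, is minus the other. -/
theorem eulerianSum_symm {p b : ℕ} (hb : b < p) :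
    eulerianSum p (p - 1 - b) = eulerianSum p b := by
  have h := sum_alternating_choose_mul_pow p (b + 1)
  have e : p + 2 = (b + 2) + (p - b) := by omega
  rw [e, sum_range_add] at h
  have h1 : ∑ d ∈ range (b + 2), (-1 : ℂ) ^ d * ((p + 1).choose d : ℂ) * ((b : ℂ) + 1 - d) ^ p =
      eulerianSum p b := sum_congr rfl fun d _ => by ring
  have h2 : ∑ x ∈ range (p - b), (-1 : ℂ) ^ (b + 2 + x) * ((p + 1).choose (b + 2 + x) : ℂ) *
      ((b : ℂ) + 1 - (b + 2 + x : ℕ)) ^ p = - eulerianSum p (p - 1 - b) := by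
    have e2 : p - 1 - b + 2 = (p - b) + 1 := by omega
    rw [eulerianSum, e2, sum_range_succ, ← sum_range_reflect]
    have hp : p ≠ 0 := by omega
    -- The sum for index p - 1 - b has one term more than the reflected upper part, but its base is
    -- 0.
    have e3 : (((p - 1 - b : ℕ) : ℂ) - (p - b : ℕ) + 1) = 0 := by
      have : p - b = (p - 1 - b) + 1 := by omega
      rw [this]
      push_cast
      ring
    rw [e3, zero_pow hp, mul_zero, add_zero, ← sum_neg_distrib]
    refine sum_congr rfl fun x hx => ?_
    have hx' := mem_range.1 hx
    have e4 : b + 2 + (p - b - 1 - x) = p + 1 - x := by omega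
    have e5 : x ≤ p + 1 := by omega
    rw [e4, Nat.choose_symm e5]
    have e6 : ((b : ℂ) + 1 - (p + 1 - x : ℕ)) = - ((p - 1 - b : ℕ) - (x : ℂ) + 1) := by
      rw [Nat.cast_sub e5]
      have : ((p - 1 - b : ℕ) : ℂ) = p - 1 - b := by
        rw [Nat.cast_sub (by omega), Nat.cast_sub (by omega)]
        simp
      rw [this]
      push_cast
      ring
    rw [e6, neg_pow (((p - 1 - b : ℕ) : ℂ) - x + 1)]
    have e7 : (-1 : ℂ) ^ (p + 1 - x) * (-1) ^ p = - (-1) ^ x := by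
      have h3 : (-1 : ℂ) ^ (p + 1 - x) * (-1) ^ x = (-1) ^ (p + 1) := by
        rw [← pow_add]
        congr 1
        omega
      have h4 : (-1 : ℂ) ^ x * (-1) ^ x = 1 := by
        rw [← mul_pow]
        simp
      have h5 : (-1 : ℂ) ^ p * (-1) ^ p = 1 := by
        rw [← mul_pow]
        simp
      calc (-1 : ℂ) ^ (p + 1 - x) * (-1) ^ p
          = ((-1 : ℂ) ^ (p + 1 - x) * (-1) ^ x) * (-1) ^ x * (-1) ^ p := by
            rw [mul_assoc ((-1 : ℂ) ^ (p + 1 - x)), h4, mul_one]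
        _ = - ((-1) ^ x) * ((-1 : ℂ) ^ p * (-1) ^ p) := by rw [h3, pow_succ]; ring
        _ = _ := by rw [h5, mul_one]
    linear_combination (((p + 1).choose x : ℂ) * ((p - 1 - b : ℕ) - (x : ℂ) + 1) ^ p) * e7
  rw [h1, h2] at h
  linear_combination -h

theorem summable_succ_pow_mul_geometric (p : ℕ) {z : ℂ} (hz : ‖z‖ < 1) :
    Summable (fun r : ℕ => ((r : ℂ) + 1) ^ p * z ^ r) := by
  have h : ∀ r : ℕ, ((r : ℂ) + 1) ^ p * z ^ r =
      ∑ l ∈ range (p + 1), (p.choose l : ℂ) * ((r : ℂ) ^ l * z ^ r) := fun r => by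
    rw [add_pow, sum_mul]
    refine sum_congr rfl fun l _ => ?_
    simp
    ring
  simp_rw [h]
  exact summable_sum fun l _ => (summable_pow_mul_geometric_of_norm_lt_one l hz).mul_left _

/-- The generating function of the powers `(r + 1) ^ p`. -/
theorem one_sub_pow_mul_tsum_succ_pow {p : ℕ} (hp : 1 ≤ p) {z : ℂ} (hz : ‖z‖ < 1) :
    (1 - z) ^ (p + 1) * ∑' r : ℕ, ((r : ℂ) + 1) ^ p * z ^ r =
      ∑ s ∈ range p, eulerianSum p s * z ^ s := by
  set L := ∑' r : ℕ, ((r : ℂ) + 1) ^ p * z ^ r with hL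
  have h0 := (summable_succ_pow_mul_geometric p hz).hasSum
  -- Multiplication by z^d shifts the coefficients by d; summing against the expansion of (1 - z)^(p
  -- + 1) gives the Cauchy product.
  have h1 : ∀ d : ℕ, HasSum
      (fun s : ℕ => if d ≤ s then ((s : ℂ) - d + 1) ^ p * z ^ s else 0) (z ^ d * L) := by
    intro d
    have h2 := h0.mul_left (z ^ d)
    have hinj : Function.Injective (fun r : ℕ => r + d) := add_left_injective d
    rw [← hinj.hasSum_iff]
    · have e : ((fun s : ℕ => if d ≤ s then ((s : ℂ) - d + 1) ^ p * z ^ s else 0) ∘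
          fun r : ℕ => r + d) = fun r : ℕ => z ^ d * (((r : ℂ) + 1) ^ p * z ^ r) := by
        funext r
        simp only [Function.comp, le_add_iff_nonneg_left, zero_le, if_true]
        push_cast
        ring
      rw [e]
      exact h2
    · intro s hs
      rw [if_neg]
      intro hds
      exact hs ⟨s - d, by simp; omega⟩
  have h2 := hasSum_sum (s := range (p + 2))
    fun d _ => (h1 d).mul_left ((-1 : ℂ) ^ d * ((p + 1).choose d : ℂ))
  have h3 : ∑ d ∈ range (p + 2), (-1 : ℂ) ^ d * ((p + 1).choose d : ℂ) * (z ^ d * L) =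
      (1 - z) ^ (p + 1) * L := by
    rw [sub_eq_neg_add, add_pow, sum_mul]
    refine sum_congr rfl fun d _ => ?_
    rw [neg_pow z]
    simp
    ring
  have h4 : ∀ s : ℕ, ∑ d ∈ range (p + 2), (-1 : ℂ) ^ d * ((p + 1).choose d : ℂ) *
      (if d ≤ s then ((s : ℂ) - d + 1) ^ p * z ^ s else 0) = eulerianSum p s * z ^ s := by
    intro s
    have e : ∀ N, p + 2 ≤ N → ∑ d ∈ range (p + 2), (-1 : ℂ) ^ d * ((p + 1).choose d : ℂ) *
        (if d ≤ s then ((s : ℂ) - d + 1) ^ p * z ^ s else 0) =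
        ∑ d ∈ range N, (-1 : ℂ) ^ d * ((p + 1).choose d : ℂ) *
        (if d ≤ s then ((s : ℂ) - d + 1) ^ p * z ^ s else 0) := fun N hN => by
      refine sum_subset (range_mono hN) fun d _ hd => ?_
      rw [Nat.choose_eq_zero_of_lt (by simp at hd; omega)]
      simp
    rw [e (p + s + 2) (by omega), eulerianSum, sum_mul]
    symm
    refine sum_subset_zero_on_sdiff (range_mono (by omega)) (fun d hd => ?_) fun d hd => ?_
    · rw [if_neg, mul_zero]
      simp only [mem_sdiff, mem_range] at hd
      omega
    · have hd' := mem_range.1 hd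
      rcases Nat.lt_succ_iff_lt_or_eq.1 hd' with h | h
      · rw [if_pos (by omega)]
        ring
      · rw [if_neg (by omega), h]
        -- The term d = s + 1 of `eulerianSum` lies outside the condition d ≤ s, but vanishes
        -- because p ≥ 1.
        have : ((s : ℂ) - (s + 1 : ℕ) + 1) = 0 := by push_cast; ring
        rw [this, zero_pow (by omega)]
        simp
  rw [h3] at h2
  simp_rw [h4] at h2
  have h5 := hasSum_sum_of_ne_finset_zero (L := SummationFilter.unconditional ℕ)
    (f := fun s => eulerianSum p s * z ^ s) (s := range p)
    fun s hs => by
      rw [eulerianSum_eq_zero (by simpa using hs), zero_mul]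
  exact h2.unique h5

/-- The rational function `Li_{-p}(z) / z`, as a polynomial in `1 / (1 - z)`. -/
noncomputable def negPolylogQuot (p : ℕ) (z : ℂ) : ℂ :=
  if p = 0 then (1 - z)⁻¹ else
    ∑ j ∈ range p, (∑ b ∈ range (p - j), eulerianSum p b * (-1) ^ j * ((p - b - 1).choose j : ℂ)) *
      ((1 - z)⁻¹) ^ (p + 1 - j)

/-- Reverse the Eulerian polynomial by symmetry, expand z^(p-1-b) = (1 - (1 - z))^(p-1-b), and
divide by (1 - z)^(p + 1). -/
theorem hasSum_negPolylogQuot (p : ℕ) {z : ℂ} (hz : ‖z‖ < 1) :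
    HasSum (fun r : ℕ => ((r : ℂ) + 1) ^ p * z ^ r) (negPolylogQuot p z) := by
  have h1 : (1 : ℂ) - z ≠ 0 := by
    intro h
    rw [← sub_eq_zero.1 h] at hz
    simp at hz
  rcases Nat.eq_zero_or_pos p with rfl | hp
  · simpa [negPolylogQuot] using hasSum_geometric_of_norm_lt_one hz
  · have h2 := one_sub_pow_mul_tsum_succ_pow hp hz
    convert (summable_succ_pow_mul_geometric p hz).hasSum using 1
    rw [negPolylogQuot, if_neg hp.ne', ← mul_right_inj' (pow_ne_zero (p + 1) h1), h2,
      ← sum_range_reflect (fun s => eulerianSum p s * z ^ s), mul_sum]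
    have h3 : ∀ b ∈ range p, eulerianSum p (p - 1 - b) * z ^ (p - 1 - b) =
        ∑ j ∈ range (p - b), eulerianSum p b * (-1) ^ j * ((p - b - 1).choose j : ℂ) *
          (1 - z) ^ j := by
      intro b hb
      have hb' := mem_range.1 hb
      rw [eulerianSum_symm hb']
      have e1 : z ^ (p - 1 - b) = (-(1 - z) + 1) ^ (p - b - 1) := by
        congr 1
        · ring
        · omega
      have e2 : p - b - 1 + 1 = p - b := by omega
      rw [e1, add_pow, e2, mul_sum]
      refine sum_congr rfl fun j _ => ?_
      rw [neg_pow]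
      simp
      ring
    rw [sum_congr rfl h3]
    have h4 : ∀ j ∈ range p, (1 - z) ^ (p + 1) *
        ((∑ b ∈ range (p - j), eulerianSum p b * (-1) ^ j * ((p - b - 1).choose j : ℂ)) *
      ((1 - z)⁻¹) ^ (p + 1 - j)) =
        ∑ b ∈ range (p - j), eulerianSum p b * (-1) ^ j * ((p - b - 1).choose j : ℂ) *
          (1 - z) ^ j := by
      intro j hj
      have e : p + 1 = (p + 1 - j) + j := by have := mem_range.1 hj; omega
      rw [← sum_mul]
      nth_rewrite 1 [e]
      rw [pow_add, inv_pow]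
      have h5 := mul_inv_cancel₀ (pow_ne_zero (p + 1 - j) h1)
      linear_combination ((1 - z) ^ j *
        ∑ b ∈ range (p - j), eulerianSum p b * (-1) ^ j * ((p - b - 1).choose j : ℂ)) * h5
    rw [sum_congr rfl h4]
    refine sum_comm' fun b j => ?_
    simp only [mem_range]
    omega

end Eulerian

/-! ### Depth two: splitting the integrand and conclusion -/

open scoped Nat

/-- The pairs `0 < m_1 < m_2`, parametrised by `m_1 - 1` and `m_2 - m_1 - 1`. -/
def mplIndexEquiv : ℕ × ℕ ≃ MPLIndex 1 where
  toFun x := ⟨![x.1 + 1, (x.1 + 1) + (x.2 + 1)], by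
    constructor
    · intro i j hij
      fin_cases i <;> fin_cases j <;> simp at hij ⊢
    · intro i
      fin_cases i <;> simp⟩
  invFun m := (m.1 0 - 1, m.1 1 - m.1 0 - 1)
  left_inv x := by
    ext
    · simp
    · simp only [Matrix.cons_val_zero, Matrix.cons_val_one]
      omega
  right_inv m := by
    have h0 := m.2.2 0
    have h1 : m.1 0 < m.1 1 := m.2.1 (by simp)
    ext i
    fin_cases i
    · simp
      omega
    · simp
      omega

theorem hasSum_mul_prod {f g : ℕ → ℂ} {a b : ℂ} (hf : HasSum f a) (hg : HasSum g b) :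
    HasSum (fun x : ℕ × ℕ => f x.1 * g x.2) (a * b) :=
  hf.mul hg (summable_mul_of_summable_norm hf.summable.norm hg.summable.norm)

/-- In m_2 = m_1 + r the variables m_1 and r are independent, so each binomial term of m_2 ^ n
factors into a product of two single series. Since l ≤ n < k, the subtraction k - l is not
truncated. -/
theorem mplSeries_depth_two {k n : ℕ} (hkn : n < k) {z : ℂ} (hz : ‖z‖ < 1) :
    mplSeries ![(k : ℤ), -(n : ℤ)] z = ∑ l ∈ Finset.range (n + 1),
      (n.choose l : ℂ) * ((z * polylogQuot (k - l) z) * (z * negPolylogQuot (n - l) z)) := by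
  have h1 : ∀ l, HasSum (fun x : ℕ × ℕ => (n.choose l : ℂ) *
      ((z * (z ^ x.1 / ((x.1 : ℂ) + 1) ^ (k - l))) *
        (z * (((x.2 : ℂ) + 1) ^ (n - l) * z ^ x.2))))
      ((n.choose l : ℂ) * ((z * polylogQuot (k - l) z) * (z * negPolylogQuot (n - l) z))) := by
    intro l
    have ha := (hasSum_polylogQuot (k - l) hz).mul_left z
    have hb := (hasSum_negPolylogQuot (n - l) hz).mul_left z
    exact (hasSum_mul_prod ha hb).mul_left _
  have h2 := hasSum_sum (s := Finset.range (n + 1)) fun l _ => h1 l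
  rw [mplSeries, ← mplIndexEquiv.tsum_eq, ← h2.tsum_eq]
  refine tsum_congr fun x => ?_
  have hx : (x.1 : ℂ) + 1 ≠ 0 := Nat.cast_add_one_ne_zero x.1
  have h3 : ∀ f : Fin (1 + 1) → ℂ, ∏ i, f i = f 0 * f 1 := fun f => Fin.prod_univ_two f
  rw [h3]
  change z ^ (x.1 + 1 + (x.2 + 1)) / (((x.1 + 1 : ℕ) : ℂ) ^ (k : ℤ) *
    ((x.1 + 1 + (x.2 + 1) : ℕ) : ℂ) ^ (-(n : ℤ))) = _
  simp only [zpow_neg, zpow_natCast]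
  push_cast
  rw [← div_div, div_inv_eq_mul, add_pow ((x.1 : ℂ) + 1), Finset.mul_sum]
  refine Finset.sum_congr rfl fun l hl => ?_
  have hl' : l ≤ n := Nat.lt_succ_iff.1 (Finset.mem_range.1 hl)
  have e2 : ((x.1 : ℂ) + 1) ^ k = ((x.1 : ℂ) + 1) ^ (k - l) * ((x.1 : ℂ) + 1) ^ l := by
    rw [← pow_add]
    congr 1
    omega
  rw [e2]
  field_simp
  ring

theorem one_sub_ne_zero_of_mem_cutPlane {z : ℂ} (hz : z ∈ cutPlane) : 1 - z ≠ 0 :=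
  Complex.slitPlane_ne_zero hz

theorem differentiableOn_negPolylogQuot (p : ℕ) :
    DifferentiableOn ℂ (negPolylogQuot p) cutPlane := by
  have h : DifferentiableOn ℂ (fun z : ℂ => (1 - z)⁻¹) cutPlane :=
    DifferentiableOn.inv (by fun_prop) fun z hz => one_sub_ne_zero_of_mem_cutPlane hz
  unfold negPolylogQuot
  split_ifs
  · exact h
  · exact DifferentiableOn.fun_sum fun j _ => (h.pow _).const_mul _

theorem isMPLContinuation_depth_two {k n : ℕ} (hkn : n < k) :
    IsMPLContinuation ![(k : ℤ), -(n : ℤ)] fun z => ∑ l ∈ Finset.range (n + 1),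
      (n.choose l : ℂ) * ((z * polylogQuot (k - l) z) * (z * negPolylogQuot (n - l) z)) where
  differentiableOn := DifferentiableOn.fun_sum fun _ _ =>
    ((differentiableOn_id.mul (differentiableOn_polylogQuot _)).mul
      (differentiableOn_id.mul (differentiableOn_negPolylogQuot _))).const_mul _
  eq_series _ hz := (mplSeries_depth_two hkn hz).symm

theorem coeffA_cast (n l j : ℕ) : ((coeffA n l j : ℝ) : ℂ) =
    (n.choose l : ℂ) * ∑ b ∈ Finset.range (n - l - j),
      eulerianSum (n - l) b * (-1) ^ j * ((n - l - b - 1).choose j : ℂ) := by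
  simp only [coeffA, eulerianSum]
  push_cast
  congr 1
  refine Finset.sum_congr rfl fun b _ => ?_
  rw [Finset.sum_mul, Finset.sum_mul]
  refine Finset.sum_congr rfl fun d _ => ?_
  rw [pow_add]
  ring

theorem negPolylogQuot_one_sub_exp (p : ℕ) (hp : p ≠ 0) (t : ℝ) :
    negPolylogQuot p (1 - Complex.exp t) = ∑ j ∈ Finset.range p,
      (∑ b ∈ Finset.range (p - j), eulerianSum p b * (-1) ^ j * ((p - b - 1).choose j : ℂ)) *
        Real.exp (-(((p : ℝ) - j + 1) * t)) := by
  rw [negPolylogQuot, if_neg hp]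
  refine Finset.sum_congr rfl fun j hj => ?_
  have hj' : j ≤ p + 1 := by
    have := Finset.mem_range.1 hj
    omega
  congr 1
  rw [sub_sub_cancel, ← Complex.exp_neg, ← Complex.exp_nat_mul, Nat.cast_sub hj']
  push_cast
  ring_nf

theorem one_sub_exp_mul_polylogQuot (q : ℕ) (t : ℝ) :
    (1 - Complex.exp t) * polylogQuot q (1 - Complex.exp t) = -(polylogNeg q t : ℂ) := by
  have h : (1 - Complex.exp t : ℂ) = ((1 - Real.exp t : ℝ) : ℂ) := by push_cast; rfl
  rw [h, polylogQuot_ofReal, polylogNeg]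
  push_cast
  ring

theorem etaIntegrand_eq {k n : ℕ} (m : ℕ) (hkn : n < k) {t : ℝ} (ht : 0 < t) :
    etaIntegrand ![(k : ℤ), -(n : ℤ)] ((m : ℂ) + 1) t =
      ((m ! * (-(∑ l ∈ Finset.range n, ∑ j ∈ Finset.range (n - l), (coeffA n l j : ℝ) *
          (gammaKernel m ((n : ℝ) - l - j + 1) t * polylogNeg (k - l) t)) -
        gammaKernel m 1 t * polylogNeg (k - n) t) : ℝ) : ℂ) := by
  have hz : (1 - Complex.exp t : ℂ) ∈ cutPlane := by
    have := ofReal_mem_cutPlane (x := 1 - Real.exp t) (by linarith [Real.exp_pos t])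
    simpa using this
  have hz0 : (1 - Complex.exp t : ℂ) ≠ 0 := by
    have h : (1 - Complex.exp t : ℂ) = ((1 - Real.exp t : ℝ) : ℂ) := by push_cast; rfl
    rw [h, Complex.ofReal_ne_zero]
    linarith [Real.one_lt_exp_iff.2 ht]
  have hm : (m ! : ℂ) ≠ 0 := by exact_mod_cast m.factorial_ne_zero
  have hlast : negPolylogQuot (n - n) (1 - Complex.exp t) = Complex.exp (-t) := by
    simp [negPolylogQuot, Complex.exp_neg]
  rw [etaIntegrand, multiPolylog_eq (isMPLContinuation_depth_two hkn) hz, add_sub_cancel_right,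
    Complex.cpow_natCast, Finset.sum_range_succ, hlast]
  -- Of the two factors z = 1 - e^t one stays outside to cancel the denominator; the other is
  -- absorbed into `polylogNeg` and yields the minus sign.
  have h1 : ∀ l ∈ Finset.range n, (n.choose l : ℂ) *
      (((1 - Complex.exp t) * polylogQuot (k - l) (1 - Complex.exp t)) *
        ((1 - Complex.exp t) * negPolylogQuot (n - l) (1 - Complex.exp t))) =
      (1 - Complex.exp t) * -∑ j ∈ Finset.range (n - l), ((coeffA n l j : ℝ) : ℂ) *
        (Real.exp (-(((n : ℝ) - l - j + 1) * t)) * polylogNeg (k - l) t) := by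
    intro l hl
    have hl' := Finset.mem_range.1 hl
    rw [one_sub_exp_mul_polylogQuot, negPolylogQuot_one_sub_exp _ (by omega),
      Nat.cast_sub hl'.le]
    rw [mul_left_comm (-(polylogNeg _ _ : ℂ)), mul_left_comm (n.choose l : ℂ)]
    congr 1
    rw [← Finset.sum_neg_distrib, Finset.mul_sum, Finset.mul_sum]
    refine Finset.sum_congr rfl fun j _ => ?_
    rw [coeffA_cast]
    ring
  rw [Finset.sum_congr rfl h1, ← Finset.mul_sum, one_sub_exp_mul_polylogQuot,
    Finset.sum_neg_distrib]
  simp only [gammaKernel]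
  push_cast
  simp only [Nat.choose_self, Nat.cast_one, one_mul]
  have h2 : ∀ l j : ℕ, (coeffA n l j : ℂ) * ((t : ℂ) ^ m / (m ! : ℂ) *
      Complex.exp (-(((n : ℂ) - l - j + 1) * t)) * (polylogNeg (k - l) t : ℂ)) =
      ((t : ℂ) ^ m / (m ! : ℂ)) * ((coeffA n l j : ℂ) *
        (Complex.exp (-(((n : ℂ) - l - j + 1) * t)) * (polylogNeg (k - l) t : ℂ))) := by
    intros
    ring
  simp_rw [h2, ← Finset.mul_sum]
  field_simp
  ring_nf

theorem integrableOn_gammaKernel_mul_polylogNeg {l k d : ℕ} (hk : k = l + d) {N : ℝ} (hN : 0 < N)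
    (m : ℕ) : IntegrableOn (fun t => gammaKernel m N t * polylogNeg (d + 1) t) (Set.Ioi 0) ∧
      ∫ t in Set.Ioi (0 : ℝ), gammaKernel m N t * polylogNeg (d + 1) t =
      ∑ a ∈ Finset.piAntidiag (Finset.Icc l k) m, ((a k : ℝ) + 1) *
        (1 / N ^ starExponent a k l) * hurwitzZetaStar (starIndex a l k) fun _ => N := by
  have h := polylogMoment_eq_ofReal hk hN m
  have hmeas : AEStronglyMeasurable (fun t => gammaKernel m N t * polylogNeg (d + 1) t)
      (volume.restrict (Set.Ioi 0)) :=
    ((continuous_gammaKernel m N).mul (continuous_polylogNeg (d + 1))).aestronglyMeasurable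
  have hpos : 0 ≤ᵐ[volume.restrict (Set.Ioi 0)]
      fun t => gammaKernel m N t * polylogNeg (d + 1) t := by
    refine (ae_restrict_iff' measurableSet_Ioi).2 (ae_of_all _ fun t ht => ?_)
    exact mul_nonneg (gammaKernel_nonneg m N (le_of_lt ht)) (polylogNeg_nonneg _ (le_of_lt ht))
  refine ⟨⟨hmeas, ?_⟩, ?_⟩
  · rw [hasFiniteIntegral_iff_ofReal hpos]
    change polylogMoment (d + 1) N m < _
    rw [h]
    exact ENNReal.ofReal_lt_top
  · rw [integral_eq_lintegral_of_nonneg_ae hpos hmeas]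
    change (polylogMoment (d + 1) N m).toReal = _
    rw [h, ENNReal.toReal_ofReal]
    refine Finset.sum_nonneg fun a _ => ?_
    have : 0 ≤ hurwitzZetaStar (starIndex a l k) fun _ => N :=
      tsum_nonneg fun m => hurwitzStarTerm_nonneg _ hN m
    positivity

theorem mainTheorem1 (m k n : ℕ) (hk : 1 ≤ k) (hkn : n < k) :
    IntegrableOn (etaIntegrand ![(k : ℤ), -(n : ℤ)] ((m : ℂ) + 1)) (Set.Ioi (0 : ℝ)) ∧
    etaFn ![(k : ℤ), -(n : ℤ)] ((m : ℂ) + 1) =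
      ((-(∑ l ∈ Finset.range n, ∑ j ∈ Finset.range (n - l),
            ∑ a ∈ Finset.piAntidiag (Finset.Icc (l + 1) k) m,
              (coeffA n l j : ℝ) * ((a k : ℝ) + 1) *
                (1 / ((n : ℝ) - l - j + 1) ^ (a (l + 1) + 1)) *
                hurwitzZetaStar (starIndex a (l + 1) k) (fun _ => (n : ℝ) - l - j + 1))
        - ∑ a ∈ Finset.piAntidiag (Finset.Icc (n + 1) k) m,
            ((a k : ℝ) + 1) *
              hurwitzZetaStar (starIndex a (n + 1) k) (fun _ => (1 : ℝ)) : ℝ) : ℂ) := by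
  have hN : ∀ l ∈ Finset.range n, ∀ j ∈ Finset.range (n - l), (0 : ℝ) < (n : ℝ) - l - j + 1 := by
    intro l hl j hj
    have hl' := Finset.mem_range.1 hl
    have hj' := Finset.mem_range.1 hj
    have : ((l + j : ℕ) : ℝ) ≤ n := by exact_mod_cast (by omega : l + j ≤ n)
    push_cast at this
    linarith
  have hA : ∀ l ∈ Finset.range n, ∀ j ∈ Finset.range (n - l), _ := fun l hl j hj =>
    integrableOn_gammaKernel_mul_polylogNeg (l := l + 1) (k := k) (d := k - l - 1)
      (by have := Finset.mem_range.1 hl; omega) (hN l hl j hj) m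
  have hB := integrableOn_gammaKernel_mul_polylogNeg (l := n + 1) (k := k) (d := k - n - 1)
    (by omega) one_pos m
  have hd : ∀ l, l < k → k - l - 1 + 1 = k - l := fun l hl => by omega
  rw [hd n hkn] at hB
  have hA1 : ∀ l ∈ Finset.range n, ∀ j ∈ Finset.range (n - l), IntegrableOn (fun t =>
      (coeffA n l j : ℝ) * (gammaKernel m ((n : ℝ) - l - j + 1) t * polylogNeg (k - l) t))
      (Set.Ioi 0) := fun l hl j hj => by
    have h := (hA l hl j hj).1
    rw [hd l ((Finset.mem_range.1 hl).trans hkn)] at h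
    exact h.const_mul _
  have hA2 : ∀ l ∈ Finset.range n, IntegrableOn (fun t => ∑ j ∈ Finset.range (n - l),
      (coeffA n l j : ℝ) * (gammaKernel m ((n : ℝ) - l - j + 1) t * polylogNeg (k - l) t))
      (Set.Ioi 0) := fun l hl => integrable_finsetSum _ (hA1 l hl)
  have hA3 := integrable_finsetSum _ hA2
  have hcongr : ∀ t ∈ Set.Ioi (0 : ℝ), etaIntegrand ![(k : ℤ), -(n : ℤ)] ((m : ℂ) + 1) t = _ :=
    fun t ht => etaIntegrand_eq m hkn ht
  constructor
  · exact (integrableOn_congr_fun hcongr measurableSet_Ioi).2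
      (((hA3.neg.sub hB.1).const_mul (m ! : ℝ)).ofReal)
  · rw [etaFn, setIntegral_congr_fun measurableSet_Ioi hcongr, integral_complex_ofReal,
      integral_const_mul, Complex.Gamma_nat_eq_factorial]
    have hm : (m ! : ℂ) ≠ 0 := by exact_mod_cast m.factorial_ne_zero
    rw [Complex.ofReal_mul, Complex.ofReal_natCast, ← mul_assoc, one_div_mul_cancel hm, one_mul]
    congr 1
    rw [integral_sub hA3.fun_neg hB.1, integral_neg, hB.2, integral_finsetSum _ hA2]
    congr 2
    · refine Finset.sum_congr rfl fun l hl => ?_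
      rw [integral_finsetSum _ (hA1 l hl)]
      refine Finset.sum_congr rfl fun j hj => ?_
      have h := (hA l hl j hj).2
      have hl' := Finset.mem_range.1 hl
      rw [hd l (hl'.trans hkn)] at h
      rw [integral_const_mul, h, Finset.mul_sum]
      refine Finset.sum_congr rfl fun a _ => ?_
      -- Since l + 1 ≤ n < k, the leading exponent is a_{l+1} + 1 without the additional 1.
      rw [starExponent, if_neg (by omega)]
      ring
    -- Here N = 1, so the leading power is 1 whatever its exponent, also when n + 1 = k.
    · exact funext fun a => by simp
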